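/- Consider the game of Cops and Robbers with $k$ cops on a finite simple graph $G$: first the cops choose a multiset of $k$ vertices to occupy, then the robber chooses a vertex; in each round, first each cop stays or moves to a neighbouring vertex, and then the robber does likewise. The robber is captured when he occupies the same vertex as some cop. Let $\operatorname{capt}_k(G)$ be the number of rounds until capture when both sides play optimally ($\infty$ if $k$ cops cannot force capture, and $0$ if the robber is captured as soon as he is placed), and let $\operatorname{th}_c(G)=\min_k\{k+\operatorname{capt}_k(G)\}$ be the cop throttling number of $G$. Let $W$ be the Lambert $W$ function, i.e. the inverse of $y=xe^x$ on $x\ge 0$. **Theorem.** If $G$ is a connected graph on $n\ge 2$ vertices, then $$\operatorname{th}_c(G)\le \frac{(2+o(1))\,n\,\sqrt{W(\log n)}}{\sqrt{\log n}},$$ where $\log$ is the natural logarithm and the $o(1)$ term depends only on $n$ (not otherwise on $G$) and tends to $0$ as $n\to\infty$. -/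

import Mathlib

namespace CopsAndRobbers

/-- A legal move of one player on `G`: stay at the current vertex or go to a neighbour. -/
def Step {V : Type*} (G : SimpleGraph V) (u v : V) : Prop :=
  v = u ∨ G.Adj u v

/-- A position of `k` cops is a function `Fin k → V` (several cops may share a vertex, so this is
a multiset of `k` vertices with labels). The robber at `r` is captured if some cop is at `r`. -/
def Captured {V : Type*} {k : ℕ} (c : Fin k → V) (r : V) : Prop :=
  ∃ i, c i = r

/-- `CopsWinWithin G t c r`: with the cops at `c`, the robber at `r` and the cops to move, the cops
can force the capture of the robber within `t` rounds, whatever the robber does. In a round, first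
every cop makes a legal move; then, unless he has just been captured, the robber makes a legal
move (to a cop's vertex if he likes, where he is captured). -/
def CopsWinWithin {V : Type*} (G : SimpleGraph V) {k : ℕ} : ℕ → (Fin k → V) → V → Prop
  | 0, c, r => Captured c r
  | t + 1, c, r => Captured c r ∨
      ∃ c' : Fin k → V, (∀ i, Step G (c i) (c' i)) ∧
        (Captured c' r ∨ ∀ r', Step G r r' → CopsWinWithin G t c' r')

/-- The number of rounds until capture under optimal play from cops at `c` and robber at `r`
(cops to move); it is `⊤` if the cops cannot force a capture in a bounded number of rounds. -/
noncomputable def roundsFrom {V : Type*} (G : SimpleGraph V) {k : ℕ} (c : Fin k → V) (r : V) : ℕ∞ :=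
  ⨅ (t : ℕ) (_ : CopsWinWithin G t c r), (t : ℕ∞)

/-- `capt(G; S)`: the capture time when the cops start on the multiset `S` given by `c`, the maximum
over all initial vertices of the robber (chosen after the cops have been placed). -/
noncomputable def captFrom {V : Type*} (G : SimpleGraph V) {k : ℕ} (c : Fin k → V) : ℕ∞ :=
  ⨆ r : V, roundsFrom G c r

/-- `capt_k(G)`: the `k`-capture time, the minimum over all initial placements of `k` cops;
it is `⊤` if `k` cops cannot capture the robber. -/
noncomputable def capt {V : Type*} (G : SimpleGraph V) (k : ℕ) : ℕ∞ :=
  ⨅ c : Fin k → V, captFrom G c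

/-- The cop throttling number `th_c(G) = min_k (k + capt_k(G))`. -/
noncomputable def copThrottling {V : Type*} (G : SimpleGraph V) : ℕ∞ :=
  ⨅ k : ℕ, ((k : ℕ∞) + capt G k)

/-- The Lambert `W` function on `[0, ∞)`: the inverse of the bijection `y ↦ y * exp y` of
`[0, ∞)` onto itself. (Only its values at nonnegative arguments are meaningful.) -/
noncomputable def lambertW : ℝ → ℝ :=
  Function.invFunOn (fun y : ℝ => y * Real.exp y) (Set.Ici 0)

/-- `y ↦ y * exp y` is a bijection of `[0, ∞)` onto itself, so `lambertW` is well defined there. -/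
theorem bijOn_mul_exp :
    Set.BijOn (fun y : ℝ => y * Real.exp y) (Set.Ici 0) (Set.Ici 0) := by
  refine ⟨fun y hy => mul_nonneg hy (Real.exp_pos y).le, ?_, ?_⟩
  · have h : StrictMonoOn (fun y : ℝ => y * Real.exp y) (Set.Ici 0) := by
      intro a ha b _ hab
      exact mul_lt_mul'' hab (Real.exp_lt_exp.2 hab) ha (Real.exp_pos a).le
    exact h.injOn
  · intro x hx
    have hx0 : (0 : ℝ) ≤ x := hx
    have hc : ContinuousOn (fun y : ℝ => y * Real.exp y) (Set.Icc 0 x) := by fun_prop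
    have hm : x ∈ Set.Icc ((0 : ℝ) * Real.exp 0) (x * Real.exp x) :=
      ⟨by simpa using hx0, le_mul_of_one_le_right hx0 (Real.one_le_exp hx0)⟩
    obtain ⟨y, hy, hyx⟩ := intermediate_value_Icc hx0 hc hm
    exact ⟨y, hy.1, hyx⟩

/-- The defining property of `W` at a nonnegative argument. -/
theorem lambertW_spec {x : ℝ} (hx : 0 ≤ x) :
    0 ≤ lambertW x ∧ lambertW x * Real.exp (lambertW x) = x :=
  ⟨Function.invFunOn_mem (bijOn_mul_exp.surjOn hx), Function.invFunOn_eq (bijOn_mul_exp.surjOn hx)⟩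

end CopsAndRobbers

/-! The cops shrink the robber's territory, then flood what remains. Stationary cops on a set `S`
guard their closed neighbourhoods; what is left is a set `A` into which every vertex has fewer than
`d` neighbours (`exists_star_cover`). Geodesics with `a * b` vertices are then removed from `A` one
by one until none remains (`exists_geodesic_decomposition`). Each is cut into `a` blocks of `b`
vertices, with one cop per block chasing the robber's image under a 1-Lipschitz retraction. These
cops are in place after `b` rounds, so the `q` geodesics, treated in turn, take `q * b` rounds
(`inv_step`). The robber is then confined to a component with at most `d ^ (a * b)` vertices. That
many cops wait at each vertex of an `R`-net (`exists_net`), and within `R` rounds they occupy the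
whole component.

With `a = b = m`, `d = m ^ 2` and `R` about `n / m ^ 2`, the block cops and the `q * b` rounds cost
at most `n / m` each. Everything else is `O(n / m ^ 2)` provided that `m ^ (2 * m ^ 2)` is slightly
below `n`. Solving `x ^ (2 * x ^ 2) = n` gives `x = exp (W (log n) / 2)`, whence the Lambert
function. -/

namespace CopsAndRobbers

/-! ### Stars, nets, geodesics and small balls -/

/-- The graph `G` with all edges that leave `A` removed. -/
def confine {V : Type*} (G : SimpleGraph V) (A : Finset V) : SimpleGraph V where
  Adj u v := G.Adj u v ∧ u ∈ A ∧ v ∈ A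
  symm := ⟨fun _ _ h => ⟨h.1.symm, h.2.2, h.2.1⟩⟩
  loopless := ⟨fun _ h => G.loopless.irrefl _ h.1⟩

theorem exists_geodesic {V : Type*} (H : SimpleGraph V) {u v : V} (h : H.Reachable u v) :
    ∃ p : ℕ → V, p 0 = u ∧ p (H.dist u v) = v ∧
      (∀ t < H.dist u v, H.Adj (p t) (p (t + 1))) ∧
      (∀ t ≤ H.dist u v, H.dist u (p t) = t) ∧
      ∀ t ≤ H.dist u v, H.dist (p t) v = H.dist u v - t := by
  obtain ⟨w, hw⟩ := h.exists_walk_length_eq_dist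
  have h1 : ∀ t ≤ H.dist u v, H.dist u (w.getVert t) ≤ t := fun t ht => by
    have := SimpleGraph.dist_le (w.take t)
    rw [SimpleGraph.Walk.take_length] at this
    omega
  have h2 : ∀ t ≤ H.dist u v, H.dist (w.getVert t) v ≤ H.dist u v - t := fun t ht => by
    have := SimpleGraph.dist_le (w.drop t)
    rw [SimpleGraph.Walk.drop_length] at this
    omega
  have h3 : ∀ t, H.dist u v ≤ H.dist u (w.getVert t) + H.dist (w.getVert t) v := fun t =>
    SimpleGraph.Reachable.dist_triangle_left ⟨w.take t⟩ v
  refine ⟨w.getVert, by simp, by rw [← hw]; simp, fun t ht => ?_, fun t ht => ?_, fun t ht => ?_⟩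
  · exact w.adj_getVert_succ (by omega)
  · have := h1 t ht; have := h2 t ht; have := h3 t; omega
  · have := h1 t ht; have := h2 t ht; have := h3 t; omega

/-- Deleting the closed neighbourhoods of few vertices leaves a set into which every vertex has
few neighbours. -/
theorem exists_star_cover {V : Type*} [Fintype V] (G : SimpleGraph V) {d : ℕ} (hd : 1 ≤ d) :
    ∃ S A : Finset V, S.card * d ≤ Fintype.card V ∧ (∀ v ∉ A, ∃ s ∈ S, Step G s v) ∧
      ∀ v, ∀ N : Finset V, (∀ w ∈ N, G.Adj v w ∧ w ∈ A) → N.card < d := by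
  classical
  let nb : Finset V → Finset V := fun S => Finset.univ.filter fun v => ∃ s ∈ S, Step G s v
  -- Take `S` largest among the sets that dominate at least `d` vertices per element. A vertex with
  -- `d` undominated neighbours could be added to it.
  obtain ⟨S, hS, hmax⟩ := Finset.exists_max_image
    (Finset.univ.filter fun S : Finset V => S.card * d ≤ (nb S).card) Finset.card
    ⟨∅, by simp⟩
  simp only [Finset.mem_filter, Finset.mem_univ, true_and] at hS hmax
  refine ⟨S, (nb S)ᶜ, hS.trans (Finset.card_le_univ _), fun v hv => ?_, fun v N hN => ?_⟩
  · simpa [nb] using hv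
  · by_contra! hlt
    have hvS : v ∉ S := fun hv => by
      obtain ⟨w, hw⟩ := Finset.card_pos.1 (lt_of_lt_of_le hd hlt)
      have := (hN w hw).2
      simp only [nb, Finset.mem_compl, Finset.mem_filter, Finset.mem_univ, true_and, not_exists,
        not_and] at this
      exact this v hv (Or.inr (hN w hw).1)
    have hdis : Disjoint (nb S) N := by
      rw [Finset.disjoint_left]
      exact fun w hw hwN => Finset.mem_compl.1 (hN w hwN).2 hw
    have hsub : nb S ∪ N ⊆ nb (insert v S) := by
      intro w hw
      simp only [nb, Finset.mem_union, Finset.mem_filter, Finset.mem_univ, true_and,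
        Finset.mem_insert] at hw ⊢
      rcases hw with ⟨s, hs, hsw⟩ | hw
      · exact ⟨s, Or.inr hs, hsw⟩
      · exact ⟨v, Or.inl rfl, Or.inr (hN w hw).1⟩
    have hc := Finset.card_le_card hsub
    rw [Finset.card_union_of_disjoint hdis] at hc
    have := hmax (insert v S) (by
      rw [Finset.card_insert_of_notMem hvS, add_mul, one_mul]; omega)
    rw [Finset.card_insert_of_notMem hvS] at this
    omega

/-- A connected graph has few vertices such that every vertex is within distance `R` of them. -/
theorem exists_net {V : Type*} [Fintype V] (G : SimpleGraph V) (hG : G.Connected) (R : ℕ) :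
    ∃ N : Finset V, N.card * (R + 1) ≤ Fintype.card V + (R + 1) ∧
      ∀ v, ∃ u ∈ N, G.dist u v ≤ R := by
  classical
  obtain ⟨ρ⟩ := hG.nonempty
  -- Sort the vertices by distance from a root modulo `R + 1`; the smallest class, together with the
  -- root, is the net.
  obtain ⟨j, hj, hcard⟩ : ∃ j ∈ Finset.range (R + 1),
      (Finset.univ.filter fun v : V => G.dist ρ v % (R + 1) = j).card * (R + 1)
        ≤ Fintype.card V := by
    by_contra! h
    have h1 := Finset.sum_lt_sum_of_nonempty (s := Finset.range (R + 1)) (by simp) h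
    have h2 := Finset.card_eq_sum_card_fiberwise (s := (Finset.univ : Finset V))
      (t := Finset.range (R + 1)) (f := fun v : V => G.dist ρ v % (R + 1))
      (fun v _ => by simpa using Nat.mod_lt _ (Nat.succ_pos R))
    rw [← Finset.sum_mul, ← h2] at h1
    simp at h1
    nlinarith
  refine ⟨insert ρ (Finset.univ.filter fun v : V => G.dist ρ v % (R + 1) = j), ?_, fun v => ?_⟩
  · have := Finset.card_insert_le ρ (Finset.univ.filter fun v : V => G.dist ρ v % (R + 1) = j)
    nlinarith
  · by_cases hv : G.dist ρ v ≤ R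
    · exact ⟨ρ, by simp, hv⟩
    · have hjR : j < R + 1 := Finset.mem_range.1 hj
      obtain ⟨p, -, -, -, hp, hp'⟩ := exists_geodesic G (hG ρ v)
      set D := G.dist ρ v
      obtain ⟨e, he1, he2, he3⟩ : ∃ e, e ≤ D ∧ D ≤ e + R ∧ e % (R + 1) = j := by
        have hdm := Nat.div_add_mod D (R + 1)
        have hm : D % (R + 1) < R + 1 := Nat.mod_lt D (Nat.succ_pos R)
        rcases le_or_gt j (D % (R + 1)) with hle | hlt
        · refine ⟨(R + 1) * (D / (R + 1)) + j, by omega, by omega, ?_⟩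
          rw [Nat.mul_add_mod, Nat.mod_eq_of_lt hjR]
        · obtain ⟨k, hk⟩ : ∃ k, D / (R + 1) = k + 1 := by
            refine Nat.exists_eq_succ_of_ne_zero (Nat.div_pos (by omega) (Nat.succ_pos R)).ne'
          rw [hk, mul_add, mul_one] at hdm
          refine ⟨(R + 1) * k + j, by omega, by omega, ?_⟩
          rw [Nat.mul_add_mod, Nat.mod_eq_of_lt hjR]
      refine ⟨p e, ?_, ?_⟩
      · simp [hp e he1, he3]
      · rw [hp' e he1]; omega

/-- Geodesics with `L` vertices can be removed one after the other until none is left. -/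
theorem exists_geodesic_decomposition {V : Type*} [DecidableEq V] [Nonempty V] (G : SimpleGraph V)
    {L : ℕ} (hL : 2 ≤ L) (A : Finset V) :
    ∃ (q : ℕ) (p : ℕ → ℕ → V) (B : ℕ → Finset V), B 0 = A ∧
      (∀ i < q, (∀ t, t + 1 < L → G.Adj (p i t) (p i (t + 1))) ∧
        (∀ t < L, (confine G (B i)).dist (p i 0) (p i t) = t) ∧
        B (i + 1) = B i \ (Finset.range L).image (p i)) ∧
      q * L + (B q).card ≤ A.card ∧ B q ⊆ A ∧
      ∀ u v, (confine G (B q)).Reachable u v → (confine G (B q)).dist u v + 1 < L := by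
  induction hn : A.card using Nat.strong_induction_on generalizing A with
  | _ n ih =>
  subst hn
  by_cases h : ∀ u v, (confine G A).Reachable u v → (confine G A).dist u v + 1 < L
  · exact ⟨0, fun _ _ => Classical.arbitrary V, fun _ => A, rfl, by simp, by simp, le_rfl, h⟩
  · push Not at h
    obtain ⟨u, v, huv, hlen⟩ := h
    obtain ⟨g, hg0, -, hgadj, hgd, -⟩ := exists_geodesic _ huv
    -- `2 ≤ L` gives the geodesic at least one edge, which puts its first vertex in `A`.
    have hmem : ∀ t < L, g t ∈ A := fun t ht => by
      rcases Nat.eq_zero_or_pos t with rfl | h0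
      · exact (hgadj 0 (by omega)).2.1
      · obtain ⟨k, rfl⟩ := Nat.exists_eq_succ_of_ne_zero h0.ne'
        exact (hgadj k (by omega)).2.2
    have hcard : (A \ (Finset.range L).image g).card + L = A.card := by
      have hsub : (Finset.range L).image g ⊆ A := by
        intro w hw
        obtain ⟨t, ht, rfl⟩ := Finset.mem_image.1 hw
        exact hmem t (Finset.mem_range.1 ht)
      have hinj : ((Finset.range L).image g).card = L := by
        rw [Finset.card_image_of_injOn, Finset.card_range]
        intro s hs t ht hst
        simp only [Finset.coe_range, Set.mem_Iio] at hs ht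
        rw [← hgd s (by omega), ← hgd t (by omega), hst]
      have := Finset.card_sdiff_add_card_eq_card hsub
      omega
    obtain ⟨q, p, B, hB0, hstep, hq, hsub, hend⟩ := ih _ (by omega) (A \ (Finset.range L).image g) rfl
    refine ⟨q + 1, fun i => i.casesOn g p, fun i => i.casesOn A B, rfl, ?_, ?_, ?_, hend⟩
    · rintro (_ | i) hi
      · refine ⟨fun t ht => (hgadj t (by omega)).1, fun t ht => ?_, hB0⟩
        show (confine G A).dist (g 0) (g t) = t
        rw [hg0]; exact hgd t (by omega)
      · exact hstep i (by omega)
    · show (q + 1) * L + (B q).card ≤ A.card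
      rw [add_mul]; omega
    · exact hsub.trans Finset.sdiff_subset

theorem card_le_pow_of_dist {V : Type*} [Fintype V] (H : SimpleGraph V) {d : ℕ}
    (hd : ∀ v, ∀ N : Finset V, (∀ w ∈ N, H.Adj v w) → N.card < d) (r : V) (L : ℕ)
    (C : Finset V) (hC : ∀ v ∈ C, H.Reachable r v ∧ H.dist r v ≤ L) : C.card ≤ d ^ L := by
  classical
  induction L generalizing C with
  | zero =>
    have : C ⊆ {r} := fun v hv => by
      have h := hC v hv
      have := (h.1.dist_eq_zero_iff).1 (Nat.le_zero.1 h.2)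
      simp [this]
    simpa using Finset.card_le_card this
  | succ L ih =>
    let D : Finset V := Finset.univ.filter fun v => H.Reachable r v ∧ H.dist r v ≤ L
    have hD : D.card ≤ d ^ L := ih D fun v hv => by simpa [D] using hv
    let nb : V → Finset V := fun v => insert v (Finset.univ.filter fun w => H.Adj v w)
    -- The strict degree bound leaves room for `v` itself, so the ball grows by a factor of at most
    -- `d`.
    have hnb : ∀ v ∈ D, (nb v).card ≤ d := fun v _ =>
      (Finset.card_insert_le _ _).trans (hd v _ fun w hw => by simpa using hw)
    have hsub : C ⊆ D.biUnion nb := fun v hv => by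
      obtain ⟨hr, hl⟩ := hC v hv
      rw [Finset.mem_biUnion]
      by_cases hle : H.dist r v ≤ L
      · exact ⟨v, by simp [D, hr, hle], by simp [nb]⟩
      · obtain ⟨p, hp0, hpe, hadj, hdist, -⟩ := exists_geodesic H hr
        have he : H.dist r v = L + 1 := by omega
        rw [he] at hpe hadj hdist
        have ha := hadj L (by omega)
        rw [hpe] at ha
        refine ⟨p L, ?_, by simp [nb, ha]⟩
        have := hdist L (by omega)
        simp [D, this, hr.trans ha.symm.reachable]
    calc C.card ≤ (D.biUnion nb).card := Finset.card_le_card hsub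
      _ ≤ D.card * d := Finset.card_biUnion_le_card_mul _ _ _ hnb
      _ ≤ d ^ L * d := Nat.mul_le_mul_right _ hD
      _ = d ^ (L + 1) := (pow_succ _ _).symm


/-! ### Strategies from invariants -/

theorem copsWinWithin_of_captured {V : Type*} {G : SimpleGraph V} {k : ℕ} {c : Fin k → V} {r : V}
    (h : Captured c r) : ∀ t, CopsWinWithin G t c r
  | 0 => h
  | _ + 1 => Or.inl h

/-- A family `Inv` of positions (indexed by the number of elapsed rounds) that the cops can
maintain until round `T` unless they capture the robber. -/
theorem copsWinWithin_of_invariant {V K : Type*} (G : SimpleGraph V) {k : ℕ} (e : Fin k ≃ K)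
    (Inv : ℕ → (K → V) → V → Prop) (T s : ℕ)
    (hend : ∀ c r, Inv T c r → CopsWinWithin G s (c ∘ e) r)
    (hstep : ∀ t < T, ∀ c r, Inv t c r → ∃ c' : K → V, (∀ i, Step G (c i) (c' i)) ∧
      ((∃ i, c' i = r) ∨ ∀ r', Step G r r' → Inv (t + 1) c' r'))
    {t T' : ℕ} (ht : t + T' = T) {c : K → V} {r : V} (h : Inv t c r) :
    CopsWinWithin G (T' + s) (c ∘ e) r := by
  induction T' generalizing t c r with
  | zero =>
    obtain rfl : t = T := by omega
    simpa using hend c r h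
  | succ n ih =>
    obtain ⟨c', hc', h'⟩ := hstep t (by omega) c r h
    rw [Nat.add_right_comm]
    refine Or.inr ⟨c' ∘ e, fun i => hc' (e i), ?_⟩
    rcases h' with ⟨i, hi⟩ | h'
    · exact Or.inl ⟨e.symm i, by simpa using hi⟩
    · exact Or.inr fun r' hr' => ih (by omega) (h' r' hr')

theorem copThrottling_le {V : Type*} (G : SimpleGraph V) {k T : ℕ} (c : Fin k → V)
    (h : ∀ r, CopsWinWithin G T c r) : copThrottling G ≤ ((k + T : ℕ) : ℕ∞) := by
  refine (iInf_le _ k).trans ?_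
  push_cast
  gcongr
  exact (iInf_le _ c).trans (iSup_le fun r => iInf₂_le T (h r))

/-! ### Chasing the robber's shadow -/

/-- Each `u : ι` stands for a cop that chases the image `f u` of the robber on the path `p u` with
`b` vertices, from round `φ u * b` on. The robber is confined to the sets `B j` one after the
other. -/
structure GuardSystem {V : Type*} (G : SimpleGraph V) (ι : Type*) (B : ℕ → Finset V)
    (S : Finset V) (b q : ℕ) where
  phase : ι → ℕ
  phase_lt : ∀ u, phase u < q
  path : ι → ℕ → V
  shadow : ι → V → ℕ
  adj_path : ∀ u t, t + 1 < b → G.Adj (path u t) (path u (t + 1))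
  shadow_lt : ∀ u v, shadow u v < b
  shadow_le_succ : ∀ u v w, G.Adj v w → v ∈ B (phase u) → w ∈ B (phase u) →
    shadow u v ≤ shadow u w + 1
  exists_path_eq : ∀ i < q, ∀ v ∈ B i, v ∉ B (i + 1) → ∃ u, phase u = i ∧ path u (shadow u v) = v
  exists_star : ∀ v ∉ B 0, ∃ s ∈ S, Step G s v

namespace GuardSystem

variable {V ι : Type*} {G : SimpleGraph V} {B : ℕ → Finset V} {S : Finset V} {b q : ℕ}

/-- The invariant of the chase at the beginning of round `t`. -/
def Inv (g : GuardSystem G ι B S b q) (t : ℕ) (x : ι → ℕ) (r : V) : Prop :=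
  ∀ u, x u < b ∧ (t ≤ g.phase u * b → x u = 0) ∧
    (r ∈ B (g.phase u) → x u ≤ g.shadow u r + 1 ∧
      -- The second alternative says that the cop has advanced in every round of its chase. Since `x
      -- u < b`, it fails once `b` rounds of the phase have passed.
      (g.shadow u r ≤ x u + 1 ∨ t ≤ g.phase u * b + x u))

theorem inv_zero (g : GuardSystem G ι B S b q) (hb : 0 < b) (r : V) : g.Inv 0 (fun _ => 0) r :=
  fun _ => ⟨hb, fun _ => rfl, fun _ => ⟨Nat.zero_le _, Or.inr (Nat.zero_le _)⟩⟩

theorem step_path (g : GuardSystem G ι B S b q) (u : ι) {x y : ℕ} (hx : x < b) (hy : y < b)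
    (hxy : x ≤ y + 1) (hyx : y ≤ x + 1) : Step G (g.path u x) (g.path u y) := by
  obtain rfl | rfl | rfl : y = x ∨ y = x + 1 ∨ x = y + 1 := by omega
  · exact Or.inl rfl
  · exact Or.inr (g.adj_path u x hy)
  · exact Or.inr (g.adj_path u y hx).symm

/-- One round of the chase: a robber outside the set where he should be is captured. -/
theorem inv_step (g : GuardSystem G ι B S b q) {t : ℕ} {x : ι → ℕ} {r : V} (h : g.Inv t x r) :
    (∃ s ∈ S, Step G s r) ∨ (∃ u, Step G (g.path u (x u)) r) ∨
    ((∀ j ≤ q, j * b ≤ t → r ∈ B j) ∧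
      ∃ x' : ι → ℕ, (∀ u, Step G (g.path u (x u)) (g.path u (x' u))) ∧
        ∀ r', Step G r r' → g.Inv (t + 1) x' r') := by
  classical
  by_cases hr : ∀ j ≤ q, j * b ≤ t → r ∈ B j
  · have hsub : ∀ u, g.phase u * b ≤ t → r ∈ B (g.phase u) := fun u hu =>
      hr _ (g.phase_lt u).le hu
    -- A cop waits for its phase because its shadow is 1-Lipschitz only inside `B (phase u)`. Then
    -- it advances until it meets the shadow and follows it.
    refine Or.inr (Or.inr ⟨hr, fun u => if t < g.phase u * b then x u
      else min (g.shadow u r) (x u + 1), fun u => ?_, fun r' hr' u => ?_⟩)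
    · obtain ⟨h1, h2, h3⟩ := h u
      dsimp only
      split_ifs with ht
      · exact Or.inl rfl
      · have h4 := h3 (hsub u (by omega))
        have := g.shadow_lt u r
        exact g.step_path u h1 (by omega) (by omega) (by omega)
    · obtain ⟨h1, h2, h3⟩ := h u
      dsimp only
      split_ifs with ht
      · have h0 := h2 (by omega)
        exact ⟨h1, fun _ => h0, fun _ => ⟨by omega, Or.inr (by omega)⟩⟩
      · have hru := hsub u (by omega)
        have h4 := h3 hru
        have h5 := g.shadow_lt u r
        refine ⟨by omega, fun _ => by omega, fun hr'u => ?_⟩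
        have h6 : g.shadow u r ≤ g.shadow u r' + 1 ∧ g.shadow u r' ≤ g.shadow u r + 1 := by
          rcases hr' with rfl | hadj
          · omega
          · exact ⟨g.shadow_le_succ u r r' hadj hru hr'u,
              g.shadow_le_succ u r' r hadj.symm hr'u hru⟩
        omega
  · have hex : ∃ j, j ≤ q ∧ j * b ≤ t ∧ r ∉ B j := by
      push Not at hr
      exact hr
    obtain ⟨hjq, hjt, hrj⟩ := Nat.find_spec hex
    -- By minimality the robber lies in the preceding set, hence on the path just removed, whose
    -- cops have finished catching up.
    have hmin := fun i => Nat.find_min (m := i) hex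
    generalize Nat.find hex = j at hjq hjt hrj hmin
    rcases j with _ | j
    · exact Or.inl (g.exists_star r hrj)
    · have hjt' : j * b + b ≤ t := by rw [← Nat.succ_mul]; exact hjt
      have hrB : r ∈ B j := by
        by_contra hne
        exact hmin j (Nat.lt_succ_self j) ⟨by omega, by omega, hne⟩
      obtain ⟨u, rfl, hu⟩ := g.exists_path_eq j (by omega) r hrB hrj
      obtain ⟨h1, -, h3⟩ := h u
      have h4 := h3 hrB
      have h5 := g.shadow_lt u r
      refine Or.inr (Or.inl ⟨u, ?_⟩)
      have := g.step_path u h1 h5 h4.1 (by omega)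
      rwa [hu] at this

theorem exists_step_dist_le (hG : G.Connected) (u v : V) {m : ℕ} (h : G.dist u v ≤ m + 1) :
    ∃ u', Step G u u' ∧ G.dist u' v ≤ m := by
  rcases Nat.eq_zero_or_pos (G.dist u v) with h0 | h0
  · exact ⟨u, Or.inl rfl, by omega⟩
  · obtain ⟨p, hp0, -, hadj, -, hd⟩ := exists_geodesic G (hG u v)
    refine ⟨p 1, Or.inr ?_, by rw [hd 1 h0]; omega⟩
    simpa [hp0] using hadj 0 h0

theorem exists_capture {K : Type*} (c : K → V) {r : V} {i : K} (h : Step G (c i) r) :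
    ∃ c' : K → V, (∀ j, Step G (c j) (c' j)) ∧ ∃ j, c' j = r := by
  classical
  refine ⟨Function.update c i r, fun j => ?_, i, by simp⟩
  by_cases hj : j = i
  · subst hj; simpa using h
  · rw [Function.update_of_ne hj]; exact Or.inl rfl

/-- The position of all cops: those that stay on `S`, the chasing ones, and further ones. -/
def position (g : GuardSystem G ι B S b q) {η : Type*} (x : ι → ℕ) (y : η → V) :
    (S ⊕ ι) ⊕ η → V :=
  Sum.elim (Sum.elim (fun s => (s : V)) fun u => g.path u (x u)) y

theorem position_step (g : GuardSystem G ι B S b q) {η : Type*} {t : ℕ} {x : ι → ℕ} {r : V}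
    (h : g.Inv t x r) {y y' : η → V} (hy : ∀ i, Step G (y i) (y' i)) :
    ∃ c', (∀ i, Step G (g.position x y i) (c' i)) ∧ ((∃ i, c' i = r) ∨
      ((∀ j ≤ q, j * b ≤ t → r ∈ B j) ∧ ∃ x', c' = g.position x' y' ∧
        ∀ r', Step G r r' → g.Inv (t + 1) x' r')) := by
  rcases g.inv_step h with ⟨s, hs, hsr⟩ | ⟨u, hu⟩ | ⟨hr, x', hx', hr'⟩
  · obtain ⟨c', h1, h2⟩ := exists_capture (g.position x y) (i := Sum.inl (Sum.inl ⟨s, hs⟩)) hsr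
    exact ⟨c', h1, Or.inl h2⟩
  · obtain ⟨c', h1, h2⟩ := exists_capture (g.position x y) (i := Sum.inl (Sum.inr u)) hu
    exact ⟨c', h1, Or.inl h2⟩
  · refine ⟨g.position x' y', ?_, Or.inr ⟨hr, x', rfl, hr'⟩⟩
    rintro ((s | u) | i)
    · exact Or.inl rfl
    · exact hx' u
    · exact hy i

/-- The chase takes `q * b` rounds, the move of the net cops `R`, and one last round lets a guard
capture a robber who has just left `B q`. -/
theorem copThrottling_le [Fintype ι] (g : GuardSystem G ι B S b q) (hb : 0 < b)
    (hG : G.Connected) {N : Finset V} {R M : ℕ} (hN : ∀ v, ∃ z ∈ N, G.dist z v ≤ R)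
    (hM : ∀ r, ∃ en : Fin M → V, ∀ v, (confine G (B q)).Reachable r v → ∃ i, en i = v) :
    copThrottling G ≤
      ((S.card + Fintype.card ι + N.card * M + (q * b + (R + 1)) : ℕ) : ℕ∞) := by
  classical
  have hK : Fintype.card ((S ⊕ ι) ⊕ (N × Fin M)) = S.card + Fintype.card ι + N.card * M := by
    simp
  let e := (Fintype.equivFinOfCardEq hK).symm
  let home : N × Fin M → V := fun i => i.1
  refine CopsAndRobbers.copThrottling_le G (g.position (fun _ => 0) home ∘ e) fun r => ?_
  refine copsWinWithin_of_invariant G e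
    (fun t c r => ∃ x, g.Inv t x r ∧ c = g.position x home) (q * b) (R + 1) ?_ ?_
    (zero_add _) ⟨_, g.inv_zero hb r, rfl⟩
  · rintro c r₀ ⟨x₀, hx₀, rfl⟩
    obtain ⟨en, hen⟩ := hM r₀
    -- Each net vertex has a cop for every vertex of the component; those whose vertex is too far
    -- stay at home.
    let target : N × Fin M → V := fun i => if G.dist i.1 (en i.2) ≤ R then en i.2 else i.1
    have htarget : ∀ i, G.dist (home i) (target i) ≤ R := fun i => by
      dsimp only [home, target]
      split_ifs with h
      · exact h
      · simp
    have hsurj : ∀ v, (confine G (B q)).Reachable r₀ v → ∃ i, target i = v := fun v hv => by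
      obtain ⟨i, rfl⟩ := hen v hv
      obtain ⟨z, hz, hzR⟩ := hN (en i)
      exact ⟨(⟨z, hz⟩, i), by simp [target, hzR]⟩
    refine copsWinWithin_of_invariant G e
      (fun t c r => ∃ x y, g.Inv t x r ∧ c = g.position x y ∧ q * b ≤ t ∧
        (∀ i, G.dist (y i) (target i) + t ≤ q * b + R) ∧
        -- Conditional, since the robber may just have left `B q`; the guards capture him in the
        -- next move if so.
        (r ∈ B q → (confine G (B q)).Reachable r₀ r)) (q * b + R) 1 ?_ ?_
      rfl ⟨x₀, home, hx₀, rfl, le_rfl, fun i => by have := htarget i; omega,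
        fun _ => SimpleGraph.Reachable.refl _⟩
    · rintro c r ⟨x, y, hx, rfl, ht, hy, hr⟩
      obtain ⟨c', hc', h⟩ := g.position_step hx (y := y) (y' := y) fun _ => Or.inl rfl
      rcases h with ⟨i, hi⟩ | ⟨hB, -⟩
      · exact Or.inr ⟨c' ∘ e, fun i => hc' (e i), Or.inl ⟨e.symm i, by simpa using hi⟩⟩
      · obtain ⟨i, hi⟩ := hsurj r (hr (hB q le_rfl ht))
        have hdist : G.dist (y i) (target i) = 0 := by have := hy i; omega
        have hyi := ((hG _ _).dist_eq_zero_iff).1 hdist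
        refine copsWinWithin_of_captured ⟨e.symm (Sum.inr i), ?_⟩ 1
        simp [position, hyi, hi]
    · rintro t ht c r ⟨x, y, hx, rfl, hqt, hy, hr⟩
      have hmove : ∀ i, ∃ v, Step G (y i) v ∧ G.dist v (target i) + (t + 1) ≤ q * b + R := by
        intro i
        have := hy i
        obtain ⟨v, hv, hvd⟩ := exists_step_dist_le hG (y i) (target i)
          (m := q * b + R - (t + 1)) (by omega)
        exact ⟨v, hv, by omega⟩
      choose y' hy' hyd using hmove
      obtain ⟨c', hc', h⟩ := g.position_step hx hy'
      refine ⟨c', hc', h.imp_right ?_⟩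
      rintro ⟨hB, x', rfl, hx'⟩ r' hr'
      refine ⟨x', y', hx' r' hr', rfl, by omega, hyd, fun hr'B => ?_⟩
      have hrB := hB q le_rfl hqt
      rcases hr' with rfl | hadj
      · exact hr hrB
      · have hadj' : (confine G (B q)).Adj r r' := ⟨hadj, hrB, hr'B⟩
        exact (hr hrB).trans hadj'.reachable
  · rintro t ht c r ⟨x, hx, rfl⟩
    obtain ⟨c', hc', h⟩ := g.position_step hx (y := home) (y' := home) fun _ => Or.inl rfl
    refine ⟨c', hc', h.imp_right ?_⟩
    rintro ⟨-, x', rfl, hx'⟩ r' hr'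
    exact ⟨x', hx' r' hr', rfl⟩

end GuardSystem

/-! ### Assembling the bound and choosing parameters -/

theorem exists_enumeration {V : Type*} (C : Finset V) (v₀ : V) {M : ℕ} (hM : C.card ≤ M) :
    ∃ en : Fin M → V, ∀ v ∈ C, ∃ i, en i = v := by
  classical
  refine ⟨fun i => if h : (i : ℕ) < C.card then C.equivFin.symm ⟨i, h⟩ else v₀, fun v hv => ?_⟩
  refine ⟨⟨C.equivFin ⟨v, hv⟩, (C.equivFin ⟨v, hv⟩).2.trans_le hM⟩, ?_⟩
  simp

/-- The general upper bound, with parameters that are free. -/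
theorem copThrottling_le_of_connected {V : Type*} [Fintype V] (G : SimpleGraph V)
    (hG : G.Connected) {a b d : ℕ} (R : ℕ) (hb : 0 < b) (hab : 2 ≤ a * b) (hd : 1 ≤ d) :
    ∃ s q ν : ℕ, s * d ≤ Fintype.card V ∧ q * (a * b) ≤ Fintype.card V ∧
      ν * (R + 1) ≤ Fintype.card V + (R + 1) ∧
      copThrottling G ≤ ((s + q * a + ν * d ^ (a * b) + (q * b + (R + 1)) : ℕ) : ℕ∞) := by
  classical
  have := hG.nonempty
  obtain ⟨S, A, hS, hstar, hdeg⟩ := exists_star_cover G hd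
  obtain ⟨N, hNcard, hN⟩ := exists_net G hG R
  obtain ⟨q, p, B, hB0, hp, hq, hBA, hend⟩ := exists_geodesic_decomposition G hab A
  have hlt : ∀ (j : Fin a) {t : ℕ}, t < b → (j : ℕ) * b + t < a * b := fun j t ht => by
    have := Nat.mul_le_mul_right b (Nat.succ_le_of_lt j.2)
    rw [Nat.succ_mul] at this
    omega
  let g : GuardSystem G (Fin q × Fin a) B S b q :=
    { phase := fun u => u.1
      phase_lt := fun u => u.1.2
      path := fun u t => p u.1 (u.2 * b + t)
      -- Distance from the start of the geodesic, clamped to the block; it fixes the vertices of the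
      -- block.
      shadow := fun u v => min (b - 1) ((confine G (B u.1)).dist (p u.1 0) v - u.2 * b)
      adj_path := fun u t ht => by
        have := hlt u.2 ht
        exact (hp u.1 u.1.2).1 (u.2 * b + t) (by omega)
      shadow_lt := fun u v => by omega
      shadow_le_succ := fun u v w hvw hv hw => by
        have hadj : (confine G (B u.1)).Adj v w := ⟨hvw, hv, hw⟩
        have := hadj.diff_dist_adj (u := p u.1 0)
        omega
      exists_path_eq := fun i hi v hv hv' => by
        obtain ⟨-, hdist, hB⟩ := hp i hi
        rw [hB, Finset.mem_sdiff, not_and, not_not] at hv'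
        obtain ⟨t, ht, rfl⟩ := Finset.mem_image.1 (hv' hv)
        rw [Finset.mem_range] at ht
        refine ⟨(⟨i, hi⟩, ⟨t / b, (Nat.div_lt_iff_lt_mul hb).2 ht⟩), rfl, ?_⟩
        dsimp only
        rw [hdist t ht]
        have h1 := Nat.div_add_mod' t b
        have h2 := Nat.mod_lt t hb
        congr 1
        omega
      exists_star := fun v hv => hstar v (by rwa [← hB0]) }
  have hM : ∀ r, ∃ en : Fin (d ^ (a * b)) → V,
      ∀ v, (confine G (B q)).Reachable r v → ∃ i, en i = v := fun r => by
    obtain ⟨en, hen⟩ := exists_enumeration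
      (Finset.univ.filter fun v => (confine G (B q)).Reachable r v) r
      (card_le_pow_of_dist (confine G (B q)) (d := d)
        (fun v N hN => hdeg v N fun w hw => ⟨(hN w hw).1, hBA (hN w hw).2.2⟩) r (a * b) _
        fun v hv => by
          have hrv : (confine G (B q)).Reachable r v := by simpa using hv
          have := hend r v hrv
          exact ⟨hrv, by omega⟩)
    exact ⟨en, fun v hv => hen v (by simpa using hv)⟩
  refine ⟨S.card, q, N.card, hS, ?_, hNcard, ?_⟩
  · have := A.card_le_univ
    omega
  · simpa using g.copThrottling_le hb hG hN hM

theorem copThrottling_le_card {V : Type*} [Fintype V] (G : SimpleGraph V) :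
    copThrottling G ≤ (Fintype.card V : ℕ∞) := by
  have := copThrottling_le G (k := Fintype.card V) (T := 0) (Fintype.equivFin V).symm
    fun r => ⟨Fintype.equivFin V r, by simp⟩
  simpa using this


/-- The two terms `n / m` come from `q * a` and `q * b`; the four terms `n / m ^ 2` from `s`, the
net cops, `R` and the last round. -/
theorem copThrottling_le_of_pow_le {V : Type*} [Fintype V] (G : SimpleGraph V)
    (hG : G.Connected) {m : ℕ} (hm : 2 ≤ m)
    (hn : (m + 1) ^ (2 * (m + 1) ^ 2) ≤ Fintype.card V) :
    ∃ k : ℕ, copThrottling G ≤ (k : ℕ∞) ∧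
      (k : ℝ) ≤ 2 * Fintype.card V / m + 4 * Fintype.card V / (m : ℝ) ^ 2 := by
  set n := Fintype.card V
  have hm2 : 0 < m ^ 2 := by positivity
  obtain ⟨s, q, ν, hs, hq, hν, hk⟩ := copThrottling_le_of_connected G hG (a := m) (b := m)
    (d := m ^ 2) (n / m ^ 2) (by omega) (by nlinarith) hm2
  refine ⟨_, hk, ?_⟩
  have hνm : ν ≤ m ^ 2 := by
    have h1 : n < m ^ 2 * (n / m ^ 2 + 1) := Nat.lt_mul_div_succ n hm2
    have h2 : ν * (n / m ^ 2 + 1) < (m ^ 2 + 1) * (n / m ^ 2 + 1) := by linarith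
    exact Nat.lt_succ_iff.1 (Nat.lt_of_mul_lt_mul_right h2)
  have hpow : m ^ 2 * (ν * (m ^ 2) ^ (m * m)) ≤ n :=
    calc m ^ 2 * (ν * (m ^ 2) ^ (m * m)) ≤ m ^ 2 * (m ^ 2 * (m ^ 2) ^ (m * m)) := by gcongr
      _ = m ^ (4 + 2 * m ^ 2) := by rw [← pow_mul, ← pow_add, ← pow_add]; congr 1; ring
      _ ≤ (m + 1) ^ (4 + 2 * m ^ 2) := Nat.pow_le_pow_left (Nat.le_succ m) _
      _ ≤ (m + 1) ^ (2 * (m + 1) ^ 2) := Nat.pow_le_pow_right (Nat.succ_pos m) (by nlinarith)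
      _ ≤ n := hn
  have hle : m ^ 2 * 1 ≤ n :=
    calc m ^ 2 * 1 ≤ (m + 1) ^ 2 := by nlinarith
      _ ≤ (m + 1) ^ (2 * (m + 1) ^ 2) := Nat.pow_le_pow_right (Nat.succ_pos m) (by nlinarith)
      _ ≤ n := hn
  have hdiv : m ^ 2 * (n / m ^ 2) ≤ n := Nat.mul_div_le n _
  have hmR : (0 : ℝ) < m := by positivity
  have key : ∀ z : ℕ, m ^ 2 * z ≤ n → (z : ℝ) ≤ n / (m : ℝ) ^ 2 := fun z hz => by
    rw [le_div_iff₀ (by positivity)]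
    have : ((m ^ 2 * z : ℕ) : ℝ) ≤ n := by exact_mod_cast hz
    push_cast at this
    linarith
  have e1 := key s (by linarith)
  have e2 := key _ hpow
  have e3 := key _ hdiv
  have e4 := key _ hle
  have e5 : ((q * m : ℕ) : ℝ) ≤ n / m := by
    rw [le_div_iff₀ hmR]
    have : ((q * m * m : ℕ) : ℝ) ≤ n := by exact_mod_cast (by linarith : q * m * m ≤ n)
    push_cast at this ⊢
    linarith
  have e6 : 2 * (n : ℝ) / m + 4 * n / (m : ℝ) ^ 2
      = n / m + n / m + (n / (m : ℝ) ^ 2 + n / (m : ℝ) ^ 2 + n / (m : ℝ) ^ 2 + n / (m : ℝ) ^ 2) := by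
    ring
  rw [e6, Nat.cast_add, Nat.cast_add, Nat.cast_add, Nat.cast_add, Nat.cast_add]
  linarith

/-! ### Asymptotics through the Lambert function -/

theorem tendsto_lambertW : Filter.Tendsto lambertW Filter.atTop Filter.atTop := by
  rw [Filter.tendsto_atTop]
  intro K
  filter_upwards [Filter.eventually_ge_atTop 0, Filter.eventually_gt_atTop (K * Real.exp K)]
    with x hx0 hx
  obtain ⟨h0, hW⟩ := lambertW_spec hx0
  by_contra! hlt
  have : lambertW x * Real.exp (lambertW x) ≤ K * Real.exp K :=
    mul_le_mul hlt.le (Real.exp_le_exp.2 hlt.le) (Real.exp_pos _).le (h0.trans hlt.le)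
  linarith

theorem tendsto_lambertW_log :
    Filter.Tendsto (fun n : ℕ => lambertW (Real.log n)) Filter.atTop Filter.atTop :=
  tendsto_lambertW.comp (Real.tendsto_log_atTop.comp tendsto_natCast_atTop_atTop)

theorem isLittleO_exp_neg_lambertW_log :
    Asymptotics.IsLittleO Filter.atTop
      (fun n : ℕ => 24 / Real.exp (lambertW (Real.log n) / 2)) (fun _ => (1 : ℝ)) := by
  rw [Asymptotics.isLittleO_one_iff]
  exact Filter.Tendsto.div_atTop tendsto_const_nhds
    (Real.tendsto_exp_atTop.comp (tendsto_lambertW_log.atTop_div_const two_pos))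

theorem sqrt_lambertW_div_sqrt {y : ℝ} (hy : 0 < y) :
    √(lambertW y) / √y = 1 / Real.exp (lambertW y / 2) := by
  obtain ⟨h0, hW⟩ := lambertW_spec hy.le
  have hpos : 0 < lambertW y := h0.lt_of_ne fun h => by
    rw [← h, zero_mul] at hW
    exact hy.ne hW
  have hsq : √y = √(lambertW y) * Real.exp (lambertW y / 2) := by
    rw [Real.exp_half, ← Real.sqrt_mul h0, hW]
  rw [hsq]
  have := Real.sqrt_pos.2 hpos
  field_simp

/-- Here `2 * x ^ 2 * log x = W * exp W = log n` for `W = lambertW (log n)`, so `m = ⌊x⌋₊ - 1` is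
admissible. Replacing `m` by `x` costs `8 / x` in the coefficient, the lower-order terms `16 / x`.
-/
theorem copThrottling_le_lambertW {V : Type*} [Fintype V] (G : SimpleGraph V)
    (hG : G.Connected) (hn : 2 ≤ Fintype.card V) {x : ℝ}
    (hx : x = Real.exp (lambertW (Real.log (Fintype.card V)) / 2)) :
    ∃ k : ℕ, copThrottling G ≤ (k : ℕ∞) ∧ (k : ℝ) ≤ (2 + 24 / x) * Fintype.card V * (1 / x) := by
  set n := Fintype.card V
  have hn0 : (0 : ℝ) < n := by exact_mod_cast (by omega : 0 < n)
  have hx0 : 0 < x := hx ▸ Real.exp_pos _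
  rcases le_or_gt x 4 with h4 | h4
  -- For small `x` the trivial bound `n` suffices, as `(2 + 24 / x) / x ≥ 1`.
  · refine ⟨n, copThrottling_le_card G, ?_⟩
    have h1 : (2 + 24 / x) * n * (1 / x) - n = n * (2 * x + 24 - x ^ 2) / x ^ 2 := by
      field_simp
    have h2 : 0 ≤ n * (2 * x + 24 - x ^ 2) / x ^ 2 :=
      div_nonneg (mul_nonneg hn0.le (by nlinarith)) (by positivity)
    linarith
  · obtain ⟨m, hm⟩ : ∃ m, ⌊x⌋₊ = m + 1 := Nat.exists_eq_succ_of_ne_zero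
      (Nat.floor_pos.2 (by linarith)).ne'
    have hmx : (m : ℝ) + 1 ≤ x := by
      have := Nat.floor_le hx0.le
      rw [hm] at this
      exact_mod_cast this
    have hxm : x - 2 ≤ m := by
      have := Nat.lt_floor_add_one x
      rw [hm] at this
      push_cast at this
      linarith
    have hm2 : 2 ≤ m := by exact_mod_cast (by linarith : (2 : ℝ) ≤ m)
    have hpow : (m + 1) ^ (2 * (m + 1) ^ 2) ≤ n := by
      obtain ⟨h0, hW⟩ := lambertW_spec (x := Real.log n) (Real.log_natCast_nonneg n)
      have hlogx : Real.log x = lambertW (Real.log n) / 2 := by rw [hx, Real.log_exp]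
      have hx2 : x ^ 2 = Real.exp (lambertW (Real.log n)) := by
        rw [hx, ← Real.exp_nat_mul]; congr 1; push_cast; ring
      have hlog : Real.log (((m + 1) ^ (2 * (m + 1) ^ 2) : ℕ) : ℝ) ≤ Real.log n := by
        push_cast
        rw [Real.log_pow]
        push_cast
        calc 2 * ((m : ℝ) + 1) ^ 2 * Real.log (m + 1) ≤ 2 * x ^ 2 * Real.log x := by
              gcongr
              exact Real.log_nonneg (by linarith [Nat.cast_nonneg (α := ℝ) m])
          _ = Real.log n := by rw [hx2, hlogx]; linarith
      exact_mod_cast (Real.log_le_log_iff (by positivity) hn0).1 hlog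
    obtain ⟨k, hk, hkle⟩ := copThrottling_le_of_pow_le G hG hm2 hpow
    refine ⟨k, hk, hkle.trans ?_⟩
    have hx2 : 0 < x - 2 := by linarith
    have hb : 1 / (m : ℝ) ≤ 1 / x + 4 / x ^ 2 :=
      calc 1 / (m : ℝ) ≤ 1 / (x - 2) := one_div_le_one_div_of_le hx2 hxm
        _ ≤ 1 / x + 4 / x ^ 2 := by
          rw [div_add_div _ _ hx0.ne' (by positivity), div_le_div_iff₀ hx2 (by positivity)]
          nlinarith
    have hc : 1 / (m : ℝ) ^ 2 ≤ 4 / x ^ 2 := by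
      have hmp : (0 : ℝ) < m := by linarith
      rw [div_le_div_iff₀ (by positivity) (by positivity)]
      nlinarith
    calc 2 * (n : ℝ) / m + 4 * n / (m : ℝ) ^ 2
        = 2 * n * (1 / m) + 4 * n * (1 / (m : ℝ) ^ 2) := by ring
      _ ≤ 2 * n * (1 / x + 4 / x ^ 2) + 4 * n * (4 / x ^ 2) := by gcongr
      _ = (2 + 24 / x) * n * (1 / x) := by ring

end CopsAndRobbers

theorem theorem2p7 :
    ∃ ε : ℕ → ℝ, Asymptotics.IsLittleO Filter.atTop ε (fun _ => (1 : ℝ)) ∧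
      ∀ (V : Type*) [Fintype V] (G : SimpleGraph V) (n : ℕ),
        G.Connected → Fintype.card V = n → 2 ≤ n →
          ∃ m : ℕ, CopsAndRobbers.copThrottling G = (m : ℕ∞) ∧
            (m : ℝ) ≤ (2 + ε n) * (n : ℝ) * Real.sqrt (CopsAndRobbers.lambertW (Real.log n)) /
              Real.sqrt (Real.log n) := by
  refine ⟨_, CopsAndRobbers.isLittleO_exp_neg_lambertW_log, fun V _ G n hG hcard hn => ?_⟩
  subst hcard
  obtain ⟨k, hk, hkle⟩ := CopsAndRobbers.copThrottling_le_lambertW G hG hn rfl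
  obtain ⟨m, hm⟩ := ENat.ne_top_iff_exists.1 (hk.trans_lt (ENat.natCast_lt_top k)).ne
  refine ⟨m, hm.symm, ?_⟩
  have hmk : m ≤ k := by
    rw [← hm] at hk
    exact_mod_cast hk
  rw [mul_div_assoc, CopsAndRobbers.sqrt_lambertW_div_sqrt
    (Real.log_pos (by exact_mod_cast (by omega : 1 < Fintype.card V)))]
  exact le_trans (by exact_mod_cast hmk) hkle
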